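/- **Semirings.** A *min-max semiring* is a commutative semiring $(A,+,\cdot,0,1)$ with $0\neq 1$ whose natural order ($a\le b$ iff $a+c=b$ for some $c$) is a total order with minimum $0$ and maximum $1$, with $+=\max$ and $\cdot=\min$. **Models.** Let $\mathcal P$ be a finite relational language with object constants (finitely many symbols). A *finite $\mathcal P$-model* $M$ over $A$ is a finite non-empty set $M$ with an element $c^M$ for each object constant $c$ and functions $R^M,(\neg R)^M:M^k\to A$ for each $k$-ary relation symbol $R$, such that for every tuple $\bar m$ precisely one of $R^M(\bar m)$, $(\neg R)^M(\bar m)$ is $0$. Its *Gaifman graph* joins distinct $m,n$ when both occur in a tuple $\bar s$ with $R^M(\bar s)>0$ for some $R\in\mathcal P$; $d$ is the graph distance (possibly $\infty$), and $B(r,m)$ is the set of all $n$ with $d(m,n)\le r$ or $d(c^M,n)\le r$ for some object constant $c$. **Formulas.** Formulas are in negation normal form: they are built from $R(\bar t)$, $\neg R(\bar t)$, $s=t$, $s\ne t$ by $\land$, $\lor$, the quantifiers $\exists y$, $\forall y$, the *ball quantifiers* $Qy\in B(r,t)$, and the *scattered quantifiers*, that is, quantifiers $Qy$ over elements with $d(t,y)>r$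 and quantifiers $Q(y_1,\dots,y_k)$ over tuples with $d(y_i,y_j)>2r$ for all $i\ne j$ (here $Q\in\{\exists,\forall\}$, $r,k\in\mathbb N$, and $s,t$ are terms). The value $\|\varphi\|^M\in A$ is defined by interpreting relational literals through $R^M$, $(\neg R)^M$, (in)equalities by $1$ if true and $0$ if false, $\lor$ by $+$, $\land$ by $\cdot$, existential quantifiers by sums and universal quantifiers by products over the indicated range. For a sentence $\varphi$ write $M\models\varphi$ iff $\|\varphi\|^M>0$. **Local sentences.** A *local formula* $\psi^{r,x}(x)$ is a formula whose only free variable is $x$ and all of whose quantifiers are ball quantifiers $Qy\in B(r,x)$ with this $r$ and $x$. A *basic local sentence* is one of the form $$\exists x_1\dots\exists x_n\Big[\bigwedge_{i\neq j} d(x_i,x_j)>2r\ \land\ \bigwedge_{i}\psi^{r,x_i}(x_i)\Big],\qquad n\ge 1,\ r\ge 0,$$ the distance condition being expressed by the scattered quantifier over $(x_1,\dots,x_n)$. **Statement.** Let $M,N$ be finite $\mathcal P$-models over the same min-max semiring $A$. If $M\models\sigma\iff N\models\sigma$ for every basic local sentence $\sigma$, then $M\equiv N$, that is, $M\models\varphi\iff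 N\models\varphi$ for every sentence $\varphi$ of the language with ball and scattered quantifiers (in particular for every ordinary negation normal form sentence). -/

import Mathlib

universe u v w x y

namespace SemiringGaifman

/-! ## Min-max semirings -/

/-- The natural preorder of a commutative semiring: `a ≤ b` iff `a + c = b` for some `c`. -/
def NatLE {A : Type w} [CommSemiring A] (a b : A) : Prop := ∃ c, a + c = b

/-- A min-max semiring: the natural order is a total order with minimum `0` and maximum `1`,
addition is the maximum and multiplication is the minimum.
(Reflexivity, transitivity and minimality of `0` hold in every commutative semiring.) -/
structure IsMinMax (A : Type w) [CommSemiring A] : Prop where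
  zero_ne_one : (0 : A) ≠ 1
  antisymm : ∀ a b : A, NatLE a b → NatLE b a → a = b
  total : ∀ a b : A, NatLE a b ∨ NatLE b a
  le_one : ∀ a : A, NatLE a 1
  add_eq_max : ∀ a b : A, NatLE a b → a + b = b
  mul_eq_min : ∀ a b : A, NatLE a b → a * b = a

/-! ## Structures -/

/-- A structure with domain `M` over the semiring `A` for the relational language with object
constants `L`: `rel R` interprets the literals `R(...)` and `nrel R` the literals `¬ R(...)`. -/
structure SStruct (L : FirstOrder.Language.{u, v}) (A : Type w) (M : Type x) where
  const : L.Constants → M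
  rel : ∀ {k : ℕ}, L.Relations k → (Fin k → M) → A
  nrel : ∀ {k : ℕ}, L.Relations k → (Fin k → M) → A

/-- Of two complementary literals precisely one has value `0`. -/
def SStruct.ModelDefining {L : FirstOrder.Language.{u, v}} {A : Type w} [CommSemiring A] {M : Type x}
    (S : SStruct L A M) : Prop :=
  ∀ (k : ℕ) (R : L.Relations k) (s : Fin k → M), Xor (S.rel R s = 0) (S.nrel R s = 0)

/-- The Gaifman graph: distinct elements are adjacent iff they occur together in a tuple to
which some relation assigns a value greater than `0`. -/
def SStruct.gaifman {L : FirstOrder.Language.{u, v}} {A : Type w} [CommSemiring A] {M : Type x}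
    (S : SStruct L A M) : SimpleGraph M :=
  SimpleGraph.fromRel fun m n =>
    ∃ (k : ℕ) (R : L.Relations k) (s : Fin k → M),
      m ∈ Set.range s ∧ n ∈ Set.range s ∧ S.rel R s ≠ 0

/-- The ball `B(r, m)`: all elements at distance at most `r` from `m` or from the interpretation
of an object constant. -/
def SStruct.ball {L : FirstOrder.Language.{u, v}} {A : Type w} [CommSemiring A] {M : Type x}
    (S : SStruct L A M) (r : ℕ) (m : M) : Set M :=
  {n | S.gaifman.edist m n ≤ (r : ℕ∞) ∨ ∃ c, S.gaifman.edist (S.const c) n ≤ (r : ℕ∞)}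

/-! ## Formulas -/

/-- Terms with variables `0, …, n - 1` over a relational language with object constants. -/
inductive Trm (L : FirstOrder.Language.{u, v}) (n : ℕ) : Type u
  | var (i : Fin n) : Trm L n
  | cst (c : L.Constants) : Trm L n

/-- Formulas in negation normal form with free variables among `0, …, n - 1`, in the language
with ball quantifiers and scattered quantifiers. A quantifier binding one variable (or `k`
variables) binds the variable `n` (or `n, …, n + k - 1`) of its matrix. -/
inductive Fml (L : FirstOrder.Language.{u, v}) : ℕ → Type (max u v)
  | rel {n k : ℕ} (R : L.Relations k) (t : Fin k → Trm L n) : Fml L n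
  | nrel {n k : ℕ} (R : L.Relations k) (t : Fin k → Trm L n) : Fml L n
  | eq {n : ℕ} (s t : Trm L n) : Fml L n
  | neq {n : ℕ} (s t : Trm L n) : Fml L n
  | and {n : ℕ} (φ ψ : Fml L n) : Fml L n
  | or {n : ℕ} (φ ψ : Fml L n) : Fml L n
  | ex {n : ℕ} (φ : Fml L (n + 1)) : Fml L n
  | all {n : ℕ} (φ : Fml L (n + 1)) : Fml L n
  /-- `∃ y ∈ B(r, t), φ` -/
  | exBall {n : ℕ} (r : ℕ) (t : Trm L n) (φ : Fml L (n + 1)) : Fml L n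
  /-- `∀ y ∈ B(r, t), φ` -/
  | allBall {n : ℕ} (r : ℕ) (t : Trm L n) (φ : Fml L (n + 1)) : Fml L n
  /-- `∃ y` at distance greater than `r` from `t` -/
  | exFar {n : ℕ} (r : ℕ) (t : Trm L n) (φ : Fml L (n + 1)) : Fml L n
  /-- `∀ y` at distance greater than `r` from `t` -/
  | allFar {n : ℕ} (r : ℕ) (t : Trm L n) (φ : Fml L (n + 1)) : Fml L n
  /-- `∃ (y₁, …, yₖ)` with pairwise distances greater than `2 r` -/
  | exScat {n : ℕ} (r k : ℕ) (φ : Fml L (n + k)) : Fml L n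
  /-- `∀ (y₁, …, yₖ)` with pairwise distances greater than `2 r` -/
  | allScat {n : ℕ} (r k : ℕ) (φ : Fml L (n + k)) : Fml L n

section Semantics

variable {L : FirstOrder.Language.{u, v}} {A : Type w} [CommSemiring A] {M : Type x}

/-- The value of a term. -/
def Trm.val (S : SStruct L A M) {n : ℕ} (a : Fin n → M) : Trm L n → M
  | .var i => a i
  | .cst c => S.const c

/-- A tuple is `r`-scattered iff its entries have pairwise distance greater than `2 r`. -/
def SStruct.Scattered (S : SStruct L A M) (r : ℕ) {k : ℕ} (b : Fin k → M) : Prop :=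
  ∀ i j, i ≠ j → ((2 * r : ℕ) : ℕ∞) < S.gaifman.edist (b i) (b j)

open Classical in
/-- The truth value `‖φ(a)‖` of a formula in a finite structure. -/
noncomputable def Fml.val [Fintype M] (S : SStruct L A M) :
    {n : ℕ} → Fml L n → (Fin n → M) → A
  | _, .rel R t, a => S.rel R fun i => (t i).val S a
  | _, .nrel R t, a => S.nrel R fun i => (t i).val S a
  | _, .eq s t, a => if s.val S a = t.val S a then 1 else 0
  | _, .neq s t, a => if s.val S a = t.val S a then 0 else 1
  | _, .and φ ψ, a => φ.val S a * ψ.val S a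
  | _, .or φ ψ, a => φ.val S a + ψ.val S a
  | _, .ex φ, a => ∑ m : M, φ.val S (Fin.snoc a m)
  | _, .all φ, a => ∏ m : M, φ.val S (Fin.snoc a m)
  | _, .exBall r t φ, a =>
      ∑ m : M with m ∈ S.ball r (t.val S a), φ.val S (Fin.snoc a m)
  | _, .allBall r t φ, a =>
      ∏ m : M with m ∈ S.ball r (t.val S a), φ.val S (Fin.snoc a m)
  | _, .exFar r t φ, a =>
      ∑ m : M with (r : ℕ∞) < S.gaifman.edist (t.val S a) m, φ.val S (Fin.snoc a m)
  | _, .allFar r t φ, a =>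
      ∏ m : M with (r : ℕ∞) < S.gaifman.edist (t.val S a) m, φ.val S (Fin.snoc a m)
  | _, .exScat r k φ, a =>
      ∑ b : Fin k → M with S.Scattered r b, φ.val S (Fin.append a b)
  | _, .allScat r k φ, a =>
      ∏ b : Fin k → M with S.Scattered r b, φ.val S (Fin.append a b)

/-- `S ⊨ φ` for a sentence `φ`: its value is greater than `0`, the minimum of the natural
order. -/
def SStruct.Models [Fintype M] (S : SStruct L A M) (φ : Fml L 0) : Prop :=
  φ.val S Fin.elim0 ≠ 0

end Semantics

/-! ## Local formulas and basic local sentences -/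

section Local

variable {L : FirstOrder.Language.{u, v}}

/-- Renaming of the variables of a term. -/
def Trm.rename {n m : ℕ} (f : Fin n → Fin m) : Trm L n → Trm L m
  | .var i => .var (f i)
  | .cst c => .cst c

/-- Extension of a renaming under a quantifier that binds `k` variables. -/
def liftRen {n m : ℕ} (f : Fin n → Fin m) (k : ℕ) : Fin (n + k) → Fin (m + k) :=
  Fin.addCases (fun i => Fin.castAdd k (f i)) (fun j => Fin.natAdd m j)

/-- Renaming of the free variables of a formula. -/
def Fml.rename : {n : ℕ} → Fml L n → {m : ℕ} → (Fin n → Fin m) → Fml L m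
  | _, .rel R t, _, f => .rel R fun i => (t i).rename f
  | _, .nrel R t, _, f => .nrel R fun i => (t i).rename f
  | _, .eq s t, _, f => .eq (s.rename f) (t.rename f)
  | _, .neq s t, _, f => .neq (s.rename f) (t.rename f)
  | _, .and φ ψ, _, f => .and (φ.rename f) (ψ.rename f)
  | _, .or φ ψ, _, f => .or (φ.rename f) (ψ.rename f)
  | _, .ex φ, _, f => .ex (φ.rename (liftRen f 1))
  | _, .all φ, _, f => .all (φ.rename (liftRen f 1))
  | _, .exBall r t φ, _, f => .exBall r (t.rename f) (φ.rename (liftRen f 1))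
  | _, .allBall r t φ, _, f => .allBall r (t.rename f) (φ.rename (liftRen f 1))
  | _, .exFar r t φ, _, f => .exFar r (t.rename f) (φ.rename (liftRen f 1))
  | _, .allFar r t φ, _, f => .allFar r (t.rename f) (φ.rename (liftRen f 1))
  | _, .exScat r k φ, _, f => .exScat r k (φ.rename (liftRen f k))
  | _, .allScat r k φ, _, f => .allScat r k (φ.rename (liftRen f k))

/-- All quantifiers of the formula are ball quantifiers `Q y ∈ B(r, xᵢ)`, with the given radius
`r` and the given variable `xᵢ` as centre. -/
def Fml.IsLocal (r : ℕ) : {n : ℕ} → Fin n → Fml L n → Prop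
  | _, _, .rel _ _ => True
  | _, _, .nrel _ _ => True
  | _, _, .eq _ _ => True
  | _, _, .neq _ _ => True
  | _, i, .and φ ψ => φ.IsLocal r i ∧ ψ.IsLocal r i
  | _, i, .or φ ψ => φ.IsLocal r i ∧ ψ.IsLocal r i
  | _, i, .exBall r' t φ => r' = r ∧ t = .var i ∧ φ.IsLocal r i.castSucc
  | _, i, .allBall r' t φ => r' = r ∧ t = .var i ∧ φ.IsLocal r i.castSucc
  | _, _, .ex _ => False
  | _, _, .all _ => False
  | _, _, .exFar _ _ _ => False
  | _, _, .allFar _ _ _ => False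
  | _, _, .exScat _ _ _ => False
  | _, _, .allScat _ _ _ => False

/-- The conjunction of the formulas `φ 0, …, φ k`. -/
def Fml.conj {n : ℕ} : (k : ℕ) → (Fin (k + 1) → Fml L n) → Fml L n
  | 0, φ => φ 0
  | k + 1, φ => .and (Fml.conj k fun i => φ i.castSucc) (φ (Fin.last (k + 1)))

/-- Basic local sentences: `∃ x₀ … xₖ` with pairwise distances greater than `2 r` such that
`ψ(x₀) ∧ … ∧ ψ(xₖ)`, where `ψ(x)` is a local formula of radius `r` around its only free
variable `x`. -/
def IsBasicLocal (σ : Fml L 0) : Prop :=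
  ∃ (r k : ℕ) (ψ : Fml L 1), ψ.IsLocal r 0 ∧
    σ = .exScat r (k + 1) (Fml.conj k fun i => ψ.rename fun _ => Fin.natAdd 0 i)

end Local

end SemiringGaifman

namespace SemiringGaifman

/-! ## Truth in min-max semirings -/

namespace IsMinMax

variable {A : Type w} [CommSemiring A]

/-! In a min-max semiring a sum is nonzero iff some term is, and a product is nonzero iff all
factors are, so being true is a Boolean notion. Since exactly one of two complementary literals
vanishes, truth depends only on the constants and on the supports of the relations. It therefore
suffices to find a bijection preserving these (`SupportIso`, `SupportIso.val_ne_zero`).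

Finiteness allows a radius `r` exceeding every finite distance in both models. Then `B(r, m)` is the
region of `m`, that is, its component together with all components of constants, and `r`-scattered
means lying in pairwise distinct components. A finite region can be described up to isomorphism by
one local formula: some tuple starting with the centre enumerates the ball and satisfies a
prescribed diagram (`charFml`). The basic local sentences built on this formula say that at least `k
+ 1` components have the given type (`models_basicLocal_charFml_iff`).

Hence both models have equally many components of each type (`card_regionIso_eq`), which yields a
type-preserving bijection of components (`exists_componentEquiv`), and the isomorphisms between
matched components glue to a global one (`exists_supportIso`). All regions contain all constants, so
the local isomorphisms agree on them. Two components of constants may have the same region, so a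
type must also record which component is the distinguished one (`RegionIso`). -/

theorem eq_zero_of_natLE_zero (hA : IsMinMax A) {a : A} (h : NatLE a 0) : a = 0 :=
  hA.antisymm a 0 h ⟨a, zero_add a⟩

theorem add_ne_zero (hA : IsMinMax A) {a b : A} : a + b ≠ 0 ↔ a ≠ 0 ∨ b ≠ 0 := by
  rw [← not_and_or, not_iff_not]
  refine ⟨fun h => ⟨hA.eq_zero_of_natLE_zero ⟨b, h⟩,
    hA.eq_zero_of_natLE_zero ⟨a, by rwa [add_comm]⟩⟩, ?_⟩
  rintro ⟨rfl, rfl⟩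
  exact add_zero 0

/-- The order is total, so the product is itself one of the two factors. -/
theorem mul_ne_zero (hA : IsMinMax A) {a b : A} : a * b ≠ 0 ↔ a ≠ 0 ∧ b ≠ 0 := by
  refine ⟨fun h => ⟨left_ne_zero_of_mul h, right_ne_zero_of_mul h⟩, ?_⟩
  rintro ⟨ha, hb⟩
  rcases hA.total a b with h | h
  · rwa [hA.mul_eq_min a b h]
  · rwa [mul_comm, hA.mul_eq_min b a h]

theorem sum_ne_zero (hA : IsMinMax A) {ι : Type*} (s : Finset ι) (f : ι → A) :
    ∑ i ∈ s, f i ≠ 0 ↔ ∃ i ∈ s, f i ≠ 0 := by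
  classical
  induction s using Finset.induction_on with
  | empty => simp
  | insert i s hi ih => rw [Finset.sum_insert hi, hA.add_ne_zero, ih]; simp

theorem prod_ne_zero (hA : IsMinMax A) {ι : Type*} (s : Finset ι) (f : ι → A) :
    ∏ i ∈ s, f i ≠ 0 ↔ ∀ i ∈ s, f i ≠ 0 := by
  classical
  induction s using Finset.induction_on with
  | empty => simpa using hA.zero_ne_one.symm
  | insert i s hi ih => rw [Finset.prod_insert hi, hA.mul_ne_zero, ih]; simp

end IsMinMax

variable {L : FirstOrder.Language.{u, v}} {A : Type w} [CommSemiring A]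

section Truth

variable {M : Type x} [Fintype M] {S : SStruct L A M} {n : ℕ} {a : Fin n → M}

theorem Fml.val_eq_ne_zero (hA : IsMinMax A) (s t : Trm L n) :
    (Fml.eq s t).val S a ≠ 0 ↔ s.val S a = t.val S a := by
  simp [Fml.val, hA.zero_ne_one.symm]

theorem Fml.val_neq_ne_zero (hA : IsMinMax A) (s t : Trm L n) :
    (Fml.neq s t).val S a ≠ 0 ↔ s.val S a ≠ t.val S a := by
  simp [Fml.val, hA.zero_ne_one.symm]

/-- This is why the supports of the positive literals alone determine truth. -/
theorem Fml.val_nrel_ne_zero (hS : S.ModelDefining) {k : ℕ} (R : L.Relations k)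
    (t : Fin k → Trm L n) : (Fml.nrel R t).val S a ≠ 0 ↔ ¬ (Fml.rel R t).val S a ≠ 0 := by
  have := hS k R fun i => (t i).val S a
  simp only [Fml.val, Xor] at this ⊢
  tauto

theorem Fml.val_and_ne_zero (hA : IsMinMax A) (φ ψ : Fml L n) :
    (Fml.and φ ψ).val S a ≠ 0 ↔ φ.val S a ≠ 0 ∧ ψ.val S a ≠ 0 := hA.mul_ne_zero

theorem Fml.val_or_ne_zero (hA : IsMinMax A) (φ ψ : Fml L n) :
    (Fml.or φ ψ).val S a ≠ 0 ↔ φ.val S a ≠ 0 ∨ ψ.val S a ≠ 0 := hA.add_ne_zero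

theorem Fml.val_ex_ne_zero (hA : IsMinMax A) (φ : Fml L (n + 1)) :
    (Fml.ex φ).val S a ≠ 0 ↔ ∃ m, φ.val S (Fin.snoc a m) ≠ 0 := by
  simp [Fml.val, hA.sum_ne_zero]

theorem Fml.val_all_ne_zero (hA : IsMinMax A) (φ : Fml L (n + 1)) :
    (Fml.all φ).val S a ≠ 0 ↔ ∀ m, φ.val S (Fin.snoc a m) ≠ 0 := by
  simp [Fml.val, hA.prod_ne_zero]

theorem Fml.val_exBall_ne_zero (hA : IsMinMax A) (r : ℕ) (t : Trm L n) (φ : Fml L (n + 1)) :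
    (Fml.exBall r t φ).val S a ≠ 0 ↔
      ∃ m ∈ S.ball r (t.val S a), φ.val S (Fin.snoc a m) ≠ 0 := by
  simp [Fml.val, hA.sum_ne_zero]

theorem Fml.val_allBall_ne_zero (hA : IsMinMax A) (r : ℕ) (t : Trm L n) (φ : Fml L (n + 1)) :
    (Fml.allBall r t φ).val S a ≠ 0 ↔
      ∀ m ∈ S.ball r (t.val S a), φ.val S (Fin.snoc a m) ≠ 0 := by
  simp [Fml.val, hA.prod_ne_zero]

theorem Fml.val_exFar_ne_zero (hA : IsMinMax A) (r : ℕ) (t : Trm L n) (φ : Fml L (n + 1)) :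
    (Fml.exFar r t φ).val S a ≠ 0 ↔
      ∃ m, (r : ℕ∞) < S.gaifman.edist (t.val S a) m ∧ φ.val S (Fin.snoc a m) ≠ 0 := by
  simp [Fml.val, hA.sum_ne_zero]

theorem Fml.val_allFar_ne_zero (hA : IsMinMax A) (r : ℕ) (t : Trm L n) (φ : Fml L (n + 1)) :
    (Fml.allFar r t φ).val S a ≠ 0 ↔
      ∀ m, (r : ℕ∞) < S.gaifman.edist (t.val S a) m → φ.val S (Fin.snoc a m) ≠ 0 := by
  simp [Fml.val, hA.prod_ne_zero]

theorem Fml.val_exScat_ne_zero (hA : IsMinMax A) (r k : ℕ) (φ : Fml L (n + k)) :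
    (Fml.exScat r k φ).val S a ≠ 0 ↔
      ∃ b : Fin k → M, S.Scattered r b ∧ φ.val S (Fin.append a b) ≠ 0 := by
  simp [Fml.val, hA.sum_ne_zero]

theorem Fml.val_allScat_ne_zero (hA : IsMinMax A) (r k : ℕ) (φ : Fml L (n + k)) :
    (Fml.allScat r k φ).val S a ≠ 0 ↔
      ∀ b : Fin k → M, S.Scattered r b → φ.val S (Fin.append a b) ≠ 0 := by
  simp [Fml.val, hA.prod_ne_zero]

theorem Fml.val_conj_ne_zero (hA : IsMinMax A) (k : ℕ) (φ : Fin (k + 1) → Fml L n) :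
    (Fml.conj k φ).val S a ≠ 0 ↔ ∀ i, (φ i).val S a ≠ 0 := by
  induction k with
  | zero => simp [Fml.conj, Fin.forall_fin_one]
  | succ k ih =>
    rw [Fml.conj, Fml.val_and_ne_zero hA, ih, Fin.forall_fin_succ' (n := k + 1)]

end Truth

/-! ## Renaming -/

section Renaming

variable {M : Type x}

theorem Trm.val_rename {A : Type w} (S : SStruct L A M) {n m : ℕ} (f : Fin n → Fin m) (a : Fin m → M)
    (t : Trm L n) : (t.rename f).val S a = t.val S (a ∘ f) := by
  cases t <;> rfl

theorem append_comp_liftRen {n m : ℕ} (f : Fin n → Fin m) (k : ℕ) (a : Fin m → M)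
    (b : Fin k → M) : Fin.append a b ∘ liftRen f k = Fin.append (a ∘ f) b := by
  funext i
  refine Fin.addCases (fun i => ?_) (fun j => ?_) i <;> simp [liftRen]

theorem snoc_comp_liftRen {n m : ℕ} (f : Fin n → Fin m) (a : Fin m → M) (b : M) :
    (Fin.snoc a b : Fin (m + 1) → M) ∘ liftRen f 1 = Fin.snoc (a ∘ f) b := by
  have := append_comp_liftRen f 1 a fun _ => b
  rwa [Fin.append_right_eq_snoc, Fin.append_right_eq_snoc] at this

theorem Fml.val_rename [Fintype M] (S : SStruct L A M) {n : ℕ} (φ : Fml L n) :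
    ∀ {m : ℕ} (f : Fin n → Fin m) (a : Fin m → M),
      (φ.rename f).val S a = φ.val S (a ∘ f) := by
  induction φ with
  | eq s t | neq s t =>
    intro m f a
    rw [Fml.rename, Fml.val, Fml.val, Trm.val_rename, Trm.val_rename]
  | exBall r t φ ih | allBall r t φ ih | exFar r t φ ih | allFar r t φ ih =>
    intro m f a
    rw [Fml.rename, Fml.val, Fml.val, Trm.val_rename]
    simp only [ih, snoc_comp_liftRen]
  | _ =>
    intro m f a
    simp_all [Fml.rename, Fml.val, Trm.val_rename, append_comp_liftRen, snoc_comp_liftRen]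

end Renaming

/-! ## Isomorphisms of the supports of the relations -/

section Iso

variable {M : Type x} {N : Type y}

/-- A bijection that preserves the constants and the supports of all relations. -/
structure SupportIso (S : SStruct L A M) (T : SStruct L A N) (F : M ≃ N) : Prop where
  const : ∀ c, F (S.const c) = T.const c
  rel : ∀ {k : ℕ} (R : L.Relations k) (s : Fin k → M),
    S.rel R s ≠ 0 ↔ T.rel R (F ∘ s) ≠ 0

variable {S : SStruct L A M} {T : SStruct L A N} {F : M ≃ N}

theorem SupportIso.adj (h : SupportIso S T F) (m n : M) :
    T.gaifman.Adj (F m) (F n) ↔ S.gaifman.Adj m n := by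
  have key : ∀ m n : M, (∃ (k : ℕ) (R : L.Relations k) (s : Fin k → N),
      F m ∈ Set.range s ∧ F n ∈ Set.range s ∧ T.rel R s ≠ 0) ↔
      ∃ (k : ℕ) (R : L.Relations k) (s : Fin k → M),
        m ∈ Set.range s ∧ n ∈ Set.range s ∧ S.rel R s ≠ 0 := by
    intro m n
    refine exists_congr fun k => exists_congr fun R => ?_
    rw [← (Equiv.arrowCongr (Equiv.refl (Fin k)) F).exists_congr_right]
    refine exists_congr fun s => ?_
    simp [h.rel R s, Equiv.arrowCongr]
  simp only [SStruct.gaifman, SimpleGraph.fromRel_adj, key, ne_eq, F.injective.eq_iff]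

theorem SupportIso.edist (h : SupportIso S T F) (m n : M) :
    T.gaifman.edist (F m) (F n) = S.gaifman.edist m n := by
  let e : S.gaifman ≃g T.gaifman := ⟨F, fun {m n} => h.adj m n⟩
  apply le_antisymm
  · refine le_iInf fun p => ?_
    simpa [e] using SimpleGraph.Walk.edist_le (p.map e.toHom)
  · refine le_iInf fun p => ?_
    have := SimpleGraph.Walk.edist_le (p.map e.symm.toHom)
    rw [SimpleGraph.Walk.length_map] at this
    simpa [e, SimpleGraph.Iso.symm] using this

theorem SupportIso.mem_ball (h : SupportIso S T F) (r : ℕ) (m n : M) :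
    F n ∈ T.ball r (F m) ↔ n ∈ S.ball r m := by
  simp only [SStruct.ball, Set.mem_ofPred_eq, ← h.const, h.edist]

theorem SupportIso.scattered (h : SupportIso S T F) (r : ℕ) {k : ℕ} (b : Fin k → M) :
    T.Scattered r (F ∘ b) ↔ S.Scattered r b := by
  simp only [SStruct.Scattered, Function.comp_apply, h.edist]

theorem SupportIso.term_val (h : SupportIso S T F) {n : ℕ} (t : Trm L n) (a : Fin n → M) :
    t.val T (F ∘ a) = F (t.val S a) := by
  cases t with
  | var i => rfl
  | cst c => exact (h.const c).symm

/-- The Gaifman graph is defined from supports, so `F` also preserves distances and carries the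
range of each quantifier onto the corresponding range. -/
theorem SupportIso.val_ne_zero [Fintype M] [Fintype N] (hA : IsMinMax A) (h : SupportIso S T F)
    (hS : S.ModelDefining) (hT : T.ModelDefining) {n : ℕ} (φ : Fml L n) :
    ∀ a : Fin n → M, φ.val S a ≠ 0 ↔ φ.val T (F ∘ a) ≠ 0 := by
  have hrel : ∀ {n k : ℕ} (R : L.Relations k) (t : Fin k → Trm L n) (a : Fin n → M),
      (Fml.rel R t).val S a ≠ 0 ↔ (Fml.rel R t).val T (F ∘ a) ≠ 0 := by
    intro n k R t a
    simp only [Fml.val, h.term_val]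
    exact h.rel R _
  have hsnoc : ∀ {n : ℕ} (a : Fin n → M) (m : M),
      (Fin.snoc (F ∘ a) (F m) : Fin (n + 1) → N) = F ∘ (Fin.snoc a m : Fin (n + 1) → M) :=
    fun a m => (Fin.comp_snoc F a m).symm
  have happ : ∀ {n k : ℕ} (a : Fin n → M) (b : Fin k → M),
      Fin.append (F ∘ a) (F ∘ b) = F ∘ Fin.append a b := by
    intro n k a b
    funext i
    refine Fin.addCases (fun i => ?_) (fun j => ?_) i <;> simp
  have hfun : ∀ {k : ℕ}, Function.Surjective fun b : Fin k → M => F ∘ b :=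
    F.surjective.comp_left
  induction φ with
  | rel R t => exact hrel R t
  | nrel R t =>
    intro a
    rw [Fml.val_nrel_ne_zero hS, Fml.val_nrel_ne_zero hT, hrel]
  | eq s t =>
    intro a
    simp only [Fml.val_eq_ne_zero hA, h.term_val, F.injective.eq_iff]
  | neq s t =>
    intro a
    simp only [Fml.val_neq_ne_zero hA, h.term_val, ne_eq, F.injective.eq_iff]
  | and φ ψ ihφ ihψ => intro a; rw [Fml.val_and_ne_zero hA, Fml.val_and_ne_zero hA, ihφ, ihψ]
  | or φ ψ ihφ ihψ => intro a; rw [Fml.val_or_ne_zero hA, Fml.val_or_ne_zero hA, ihφ, ihψ]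
  | ex φ ih =>
    intro a
    rw [Fml.val_ex_ne_zero hA, Fml.val_ex_ne_zero hA, F.surjective.exists]
    simp only [hsnoc, ih]
  | all φ ih =>
    intro a
    rw [Fml.val_all_ne_zero hA, Fml.val_all_ne_zero hA, F.surjective.forall]
    simp only [hsnoc, ih]
  | exBall r t φ ih =>
    intro a
    rw [Fml.val_exBall_ne_zero hA, Fml.val_exBall_ne_zero hA, F.surjective.exists]
    simp only [hsnoc, ih, h.term_val, h.mem_ball]
  | allBall r t φ ih =>
    intro a
    rw [Fml.val_allBall_ne_zero hA, Fml.val_allBall_ne_zero hA, F.surjective.forall]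
    simp only [hsnoc, ih, h.term_val, h.mem_ball]
  | exFar r t φ ih =>
    intro a
    rw [Fml.val_exFar_ne_zero hA, Fml.val_exFar_ne_zero hA, F.surjective.exists]
    simp only [hsnoc, ih, h.term_val, h.edist]
  | allFar r t φ ih =>
    intro a
    rw [Fml.val_allFar_ne_zero hA, Fml.val_allFar_ne_zero hA, F.surjective.forall]
    simp only [hsnoc, ih, h.term_val, h.edist]
  | exScat r k φ ih =>
    intro a
    rw [Fml.val_exScat_ne_zero hA, Fml.val_exScat_ne_zero hA, hfun.exists]
    simp only [happ, ih, h.scattered]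
  | allScat r k φ ih =>
    intro a
    rw [Fml.val_allScat_ne_zero hA, Fml.val_allScat_ne_zero hA, hfun.forall]
    simp only [happ, ih, h.scattered]

end Iso

/-! ## Regions: the component of an element and the components of the constants -/

section Region

variable {M : Type x} {N : Type y}

/-- The elements connected to `m` or to an object constant. -/
def SStruct.region (S : SStruct L A M) (m : M) : Set M :=
  {n | S.gaifman.Reachable m n ∨ ∃ c, S.gaifman.Reachable (S.const c) n}

/-- A walk can be shortened to a path, and a path has fewer edges than the graph has vertices. -/
theorem edist_le_card_iff [Fintype M] (G : SimpleGraph M) {r : ℕ} (hr : Fintype.card M ≤ r)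
    (m n : M) : G.edist m n ≤ (r : ℕ∞) ↔ G.Reachable m n := by
  classical
  refine ⟨fun h => SimpleGraph.reachable_of_edist_ne_top
    (ne_top_of_le_ne_top (ENat.natCast_ne_top r) h), fun ⟨p⟩ => ?_⟩
  refine (SimpleGraph.Walk.edist_le p.toPath.1).trans ?_
  exact_mod_cast (p.toPath.2.length_lt.le.trans hr)

theorem SStruct.ball_eq_region [Fintype M] (S : SStruct L A M) {r : ℕ}
    (hr : Fintype.card M ≤ r) (m : M) : S.ball r m = S.region m := by
  simp only [SStruct.ball, SStruct.region, edist_le_card_iff _ hr]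

theorem SStruct.scattered_iff [Fintype M] (S : SStruct L A M) {r : ℕ}
    (hr : Fintype.card M ≤ r) {k : ℕ} (b : Fin k → M) :
    S.Scattered r b ↔ Function.Injective fun i => S.gaifman.connectedComponentMk (b i) := by
  simp only [SStruct.Scattered, ← not_le, edist_le_card_iff _ (show Fintype.card M ≤ 2 * r by omega),
    Function.Injective, SimpleGraph.ConnectedComponent.eq]
  exact forall_congr' fun i => forall_congr' fun j => not_imp_not

theorem SStruct.mem_region_self (S : SStruct L A M) (m : M) : m ∈ S.region m := Or.inl .rfl

theorem SStruct.const_mem_region (S : SStruct L A M) (m : M) (c : L.Constants) :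
    S.const c ∈ S.region m := Or.inr ⟨c, .rfl⟩

theorem SStruct.region_eq (S : SStruct L A M) {m n : M} (h : S.gaifman.Reachable m n) :
    S.region m = S.region n := by
  ext u
  exact or_congr_left ⟨h.symm.trans, h.trans⟩

theorem SStruct.mem_region_of_reachable (S : SStruct L A M) {m n n' : M} (h : n ∈ S.region m)
    (hn : S.gaifman.Reachable n n') : n' ∈ S.region m :=
  h.imp (fun h => h.trans hn) fun ⟨c, h⟩ => ⟨c, h.trans hn⟩

theorem SStruct.reachable_of_rel (S : SStruct L A M) {k : ℕ} {R : L.Relations k} {s : Fin k → M}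
    (h : S.rel R s ≠ 0) (i j : Fin k) : S.gaifman.Reachable (s i) (s j) := by
  by_cases hij : s i = s j
  · rw [hij]
  · refine SimpleGraph.Adj.reachable ?_
    rw [SStruct.gaifman, SimpleGraph.fromRel_adj]
    exact ⟨hij, Or.inl ⟨k, R, s, ⟨i, rfl⟩, ⟨j, rfl⟩, h⟩⟩

/-- `f` and `g` restrict to mutually inverse isomorphisms between the regions of `m` and `n`. -/
structure RegionMaps (S : SStruct L A M) (T : SStruct L A N) (m : M) (n : N)
    (f : M → N) (g : N → M) : Prop where
  map : ∀ u ∈ S.region m, f u ∈ T.region n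
  map' : ∀ v ∈ T.region n, g v ∈ S.region m
  left_inv : ∀ u ∈ S.region m, g (f u) = u
  right_inv : ∀ v ∈ T.region n, f (g v) = v
  const : ∀ c, f (S.const c) = T.const c
  rel : ∀ {k : ℕ} (R : L.Relations k) (s : Fin k → M), (∀ i, s i ∈ S.region m) →
    (S.rel R s ≠ 0 ↔ T.rel R (f ∘ s) ≠ 0)

variable {S : SStruct L A M} {T : SStruct L A N} {m : M} {n : N} {f : M → N} {g : N → M}

theorem RegionMaps.symm (h : RegionMaps S T m n f g) : RegionMaps T S n m g f where
  map := h.map'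
  map' := h.map
  left_inv := h.right_inv
  right_inv := h.left_inv
  const c := by rw [← h.const, h.left_inv _ (S.const_mem_region m c)]
  rel R s hs := by
    rw [h.rel R (g ∘ s) fun i => h.map' _ (hs i)]
    have : f ∘ g ∘ s = s := funext fun i => h.right_inv _ (hs i)
    rw [this]

/-- An edge is witnessed by a tuple in some support. All entries of that tuple lie in one component,
hence in the region, where `f` preserves supports. -/
theorem RegionMaps.reachable (h : RegionMaps S T m n f g) {u u' : M} (hu : u ∈ S.region m)
    (huu' : S.gaifman.Reachable u u') : T.gaifman.Reachable (f u) (f u') := by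
  obtain ⟨p⟩ := huu'
  induction p with
  | nil => rfl
  | @cons u v w hadj p ih =>
    refine SimpleGraph.Reachable.trans ?_ (ih (S.mem_region_of_reachable hu hadj.reachable))
    have key : ∀ {k : ℕ} (R : L.Relations k) (s : Fin k → M), u ∈ Set.range s →
        v ∈ Set.range s → S.rel R s ≠ 0 → T.gaifman.Reachable (f u) (f v) := by
      rintro k R s ⟨i, rfl⟩ ⟨j, rfl⟩ hR
      refine T.reachable_of_rel ((h.rel R s fun l => ?_).1 hR) i j
      exact S.mem_region_of_reachable hu (S.reachable_of_rel hR i l)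
    rw [SStruct.gaifman, SimpleGraph.fromRel_adj] at hadj
    obtain ⟨-, ⟨k, R, s, h1, h2, h3⟩ | ⟨k, R, s, h1, h2, h3⟩⟩ := hadj
    · exact key R s h1 h2 h3
    · exact key R s h2 h1 h3

/-- The regions of `m` and `n` are isomorphic by an isomorphism that maps the component of `m`
onto the component of `n`. -/
def RegionIso (S : SStruct L A M) (T : SStruct L A N) (m : M) (n : N) : Prop :=
  ∃ (f : M → N) (g : N → M), RegionMaps S T m n f g ∧
    ∀ u ∈ S.region m, S.gaifman.Reachable m u ↔ T.gaifman.Reachable n (f u)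

theorem RegionIso.refl (S : SStruct L A M) (m : M) : RegionIso S S m m :=
  ⟨id, id, ⟨fun _ h => h, fun _ h => h, fun _ _ => rfl, fun _ _ => rfl, fun _ => rfl,
    fun _ _ _ => Iff.rfl⟩, fun _ _ => Iff.rfl⟩

theorem RegionIso.symm (h : RegionIso S T m n) : RegionIso T S n m := by
  obtain ⟨f, g, h, hr⟩ := h
  refine ⟨g, f, h.symm, fun v hv => ?_⟩
  rw [hr _ (h.map' v hv), h.right_inv v hv]

theorem RegionIso.trans {P : Type*} {U : SStruct L A P} {p : P} (h : RegionIso S T m n)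
    (h' : RegionIso T U n p) : RegionIso S U m p := by
  obtain ⟨f, g, h, hr⟩ := h
  obtain ⟨f', g', h', hr'⟩ := h'
  refine ⟨f' ∘ f, g ∘ g', ⟨fun u hu => h'.map _ (h.map u hu), fun v hv => h.map' _ (h'.map' v hv),
    fun u hu => ?_, fun v hv => ?_, fun c => ?_, fun R s hs => ?_⟩, fun u hu => ?_⟩
  · simp [h'.left_inv _ (h.map u hu), h.left_inv u hu]
  · simp [h.right_inv _ (h'.map' v hv), h'.right_inv v hv]
  · simp [h.const, h'.const]
  · rw [h.rel R s hs, h'.rel R (f ∘ s) fun i => h.map _ (hs i)]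
    rfl
  · rw [hr u hu, hr' _ (h.map u hu)]
    rfl

/-- The type belongs to the component and not to the chosen element, so components can be compared
through arbitrary representatives. -/
theorem RegionIso.congr_right (h : RegionIso S T m n) {n' : N} (hn : T.gaifman.Reachable n n') :
    RegionIso S T m n' := by
  obtain ⟨f, g, h, hr⟩ := h
  have e := T.region_eq hn
  refine ⟨f, g, ⟨?_, ?_, h.left_inv, ?_, h.const, h.rel⟩, fun u hu => ?_⟩
  · rw [← e]; exact h.map
  · rw [← e]; exact h.map'
  · rw [← e]; exact h.right_inv
  · rw [hr u hu]; exact ⟨hn.symm.trans, hn.trans⟩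

/-- If base point goes to base point, the distinguished components correspond automatically, because
both maps preserve reachability. -/
theorem RegionMaps.regionIso (h : RegionMaps S T m (f m) f g) : RegionIso S T m (f m) := by
  refine ⟨f, g, h, fun u hu => ⟨h.reachable (S.mem_region_self m), fun hu' => ?_⟩⟩
  have := h.symm.reachable (T.mem_region_self _) hu'
  rwa [h.left_inv u hu, h.left_inv m (S.mem_region_self m)] at this

theorem RegionIso.exists_maps (h : RegionIso S T m n) : ∃ (f : M → N) (g : N → M),
    T.gaifman.Reachable n (f m) ∧ RegionMaps S T m (f m) f g := by
  obtain ⟨f, g, h, hr⟩ := h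
  have hn := (hr m (S.mem_region_self m)).1 .rfl
  have e := T.region_eq hn
  refine ⟨f, g, hn, ?_, ?_, h.left_inv, ?_, h.const, h.rel⟩
  · rw [← e]; exact h.map
  · rw [← e]; exact h.map'
  · rw [← e]; exact h.right_inv

end Region

/-! ## Gluing -/

section Glue

variable {M : Type x} {N : Type y} {S : SStruct L A M} {T : SStruct L A N}

theorem reachable_out (G : SimpleGraph M) (m : M) :
    G.Reachable (Quot.out (G.connectedComponentMk m)) m :=
  SimpleGraph.ConnectedComponent.exact (Quot.out_eq _)

/-- On each component `D` the glued map is the restriction of the region isomorphism chosen for `D`.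
A tuple in a support never meets two components, so relations are checked one component at a time.
-/
theorem exists_supportIso [Nonempty M]
    (β : S.gaifman.ConnectedComponent ≃ T.gaifman.ConnectedComponent)
    (h : ∀ D, RegionIso S T (Quot.out D) (Quot.out (β D))) : ∃ F : M ≃ N, SupportIso S T F := by
  choose f g hfg hr using h
  let c := S.gaifman.connectedComponentMk
  let c' := T.gaifman.connectedComponentMk
  have hreg : ∀ m, m ∈ S.region (Quot.out (c m)) := fun m => Or.inl (reachable_out _ m)
  have hreg' : ∀ n, n ∈ T.region (Quot.out (c' n)) := fun n => Or.inl (reachable_out _ n)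
  -- The marking of the distinguished component is what sends `D` into `β D`.
  have hF : ∀ m, c' (f (c m) m) = β (c m) := fun m => by
    rw [← Quot.out_eq (β (c m))]
    exact (SimpleGraph.ConnectedComponent.sound
      ((hr _ m (hreg m)).1 (reachable_out _ m))).symm
  have hreg'' : ∀ n, n ∈ T.region (Quot.out (β (β.symm (c' n)))) := fun n => by
    rw [β.apply_symm_apply]; exact hreg' n
  have hG : ∀ n, c (g (β.symm (c' n)) n) = β.symm (c' n) := fun n => by
    conv_rhs => rw [← Quot.out_eq (β.symm (c' n))]
    refine (SimpleGraph.ConnectedComponent.sound ?_).symm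
    rw [hr _ _ ((hfg _).map' n (hreg'' n)), (hfg _).right_inv n (hreg'' n), β.apply_symm_apply]
    exact reachable_out _ n
  let F : M ≃ N :=
    { toFun := fun m => f (c m) m
      invFun := fun n => g (β.symm (c' n)) n
      left_inv := fun m => by
        simp only [hF, β.symm_apply_apply]
        exact (hfg _).left_inv m (hreg m)
      right_inv := fun n => by
        simp only [hG]
        exact (hfg _).right_inv n (hreg'' n) }
  have hrel : ∀ {k : ℕ} (R : L.Relations k) (s : Fin k → M) (D), (∀ i, c (s i) = D) →
      (S.rel R s ≠ 0 ↔ T.rel R (F ∘ s) ≠ 0) := by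
    intro k R s D hs
    rw [(hfg D).rel R s fun i => by rw [← hs i]; exact hreg _]
    have : f D ∘ s = F ∘ s := funext fun i => by simp [F, hs i]
    rw [this]
  refine ⟨F, fun d => (hfg _).const d, fun {k} R s => ?_⟩
  obtain ⟨m⟩ := ‹Nonempty M›
  -- A nullary relation has no entry that selects a component; any component will do, and one exists
  -- because `M` is nonempty.
  rcases k with _ | k
  · exact hrel R s (c m) fun i => i.elim0
  refine ⟨fun hR => ?_, fun hR => ?_⟩
  · exact (hrel R s (c (s 0)) fun i =>
      SimpleGraph.ConnectedComponent.sound (S.reachable_of_rel hR i 0)).1 hR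
  -- Here only the image tuple is known to be connected; injectivity of `β` pulls this back to `M`.
  · refine (hrel R s (c (s 0)) fun i => β.injective ?_).2 hR
    rw [← hF, ← hF]
    exact SimpleGraph.ConnectedComponent.sound (T.reachable_of_rel hR i 0)

end Glue

/-! ## Characteristic formulas of regions -/

section Characteristic

/-- The conjunction of the formulas of a list. -/
def Fml.listConj {n : ℕ} : List (Fml L (n + 1)) → Fml L (n + 1)
  | [] => .eq (.var 0) (.var 0)
  | φ :: l => .and φ (Fml.listConj l)

/-- The disjunction of the formulas of a list. -/
def Fml.listDisj {n : ℕ} : List (Fml L (n + 1)) → Fml L (n + 1)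
  | [] => .neq (.var 0) (.var 0)
  | φ :: l => .or φ (Fml.listDisj l)

/-- The quantifier string `∃ x₁ ∈ B(r, x₀) … ∃ xₘ ∈ B(r, x₀)`. -/
def Fml.exBalls (r : ℕ) : (m : ℕ) → Fml L (m + 1) → Fml L 1
  | 0, φ => φ
  | m + 1, φ => Fml.exBalls r m (.exBall r (.var 0) φ)

theorem Fml.isLocal_listConj {n : ℕ} {r : ℕ} {i : Fin (n + 1)} {l : List (Fml L (n + 1))}
    (h : ∀ φ ∈ l, φ.IsLocal r i) : (Fml.listConj l).IsLocal r i := by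
  induction l with
  | nil => trivial
  | cons φ l ih => exact ⟨h φ (by simp), ih fun ψ hψ => h ψ (by simp [hψ])⟩

theorem Fml.isLocal_listDisj {n : ℕ} {r : ℕ} {i : Fin (n + 1)} {l : List (Fml L (n + 1))}
    (h : ∀ φ ∈ l, φ.IsLocal r i) : (Fml.listDisj l).IsLocal r i := by
  induction l with
  | nil => trivial
  | cons φ l ih => exact ⟨h φ (by simp), ih fun ψ hψ => h ψ (by simp [hψ])⟩

theorem Fml.isLocal_exBalls {r m : ℕ} {φ : Fml L (m + 1)} (h : φ.IsLocal r 0) :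
    (Fml.exBalls r m φ).IsLocal r 0 := by
  induction m with
  | zero => exact h
  | succ m ih => exact ih ⟨rfl, rfl, h⟩

variable {N : Type y} [Fintype N] {T : SStruct L A N}

theorem Fml.val_listConj_ne_zero (hA : IsMinMax A) {n : ℕ} (l : List (Fml L (n + 1)))
    (b : Fin (n + 1) → N) : (Fml.listConj l).val T b ≠ 0 ↔ ∀ φ ∈ l, φ.val T b ≠ 0 := by
  induction l with
  | nil => simp [Fml.listConj, Fml.val_eq_ne_zero hA]
  | cons φ l ih => rw [Fml.listConj, Fml.val_and_ne_zero hA, ih]; simp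

theorem Fml.val_listDisj_ne_zero (hA : IsMinMax A) {n : ℕ} (l : List (Fml L (n + 1)))
    (b : Fin (n + 1) → N) : (Fml.listDisj l).val T b ≠ 0 ↔ ∃ φ ∈ l, φ.val T b ≠ 0 := by
  induction l with
  | nil => simp [Fml.listDisj, Fml.val]
  | cons φ l ih => rw [Fml.listDisj, Fml.val_or_ne_zero hA, ih]; simp

theorem SStruct.mem_ball_self {M : Type x} (S : SStruct L A M) (r : ℕ) (m : M) :
    m ∈ S.ball r m := Or.inl (by simp)

theorem Fml.val_exBalls_ne_zero (hA : IsMinMax A) (r m : ℕ) (φ : Fml L (m + 1))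
    (a : Fin 1 → N) : (Fml.exBalls r m φ).val T a ≠ 0 ↔
      ∃ b : Fin (m + 1) → N, b 0 = a 0 ∧ (∀ i, b i ∈ T.ball r (a 0)) ∧ φ.val T b ≠ 0 := by
  induction m with
  | zero =>
    refine ⟨fun h => ⟨a, rfl, fun i => ?_, h⟩, fun ⟨b, h0, _, h⟩ => ?_⟩
    · rw [Fin.fin_one_eq_zero i]; exact T.mem_ball_self r _
    · have : b = a := funext fun i => by rw [Fin.fin_one_eq_zero i]; exact h0
      rwa [this] at h
  | succ m ih =>
    rw [Fml.exBalls, ih]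
    simp only [Fml.val_exBall_ne_zero hA, Trm.val]
    constructor
    · rintro ⟨b, h0, hb, n, hn, h⟩
      refine ⟨Fin.snoc b n, ?_, fun i => ?_, h⟩
      · rw [← h0, ← Fin.castSucc_zero, Fin.snoc_castSucc]
      · refine Fin.lastCases ?_ (fun i => ?_) i
        · rw [Fin.snoc_last, ← h0]; exact hn
        · rw [Fin.snoc_castSucc]; exact hb i
    · rintro ⟨b, h0, hb, h⟩
      refine ⟨fun i => b i.castSucc, h0, fun i => hb _, b (Fin.last _), ?_, ?_⟩
      · have : b (Fin.castSucc (0 : Fin (m + 1))) = a 0 := h0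
        beta_reduce
        rw [this]
        exact hb _
      · have : (Fin.snoc (fun i => b i.castSucc) (b (Fin.last _)) : Fin (m + 1 + 1) → N) = b :=
          Fin.snoc_init_self b
        rwa [this]

/-- The atomic formulas in `n` variables. -/
abbrev AtomIndex (L : FirstOrder.Language.{u, v}) (n : ℕ) :=
  (Trm L n × Trm L n) ⊕ (Σ R : (Σ k, L.Relations k), Fin R.1 → Trm L n)

theorem Trm.finite [Finite L.Symbols] (n : ℕ) : Finite (Trm L n) := by
  have : Finite (Σ k, L.Functions k) :=
    Finite.of_injective (Sum.inl : _ → L.Symbols) Sum.inl_injective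
  have : Finite L.Constants := Finite.of_injective
    (fun c : L.Functions 0 => (⟨0, c⟩ : Σ k, L.Functions k)) fun _ _ h => by simpa using h
  refine Finite.of_surjective
    (Sum.elim Trm.var Trm.cst : Fin n ⊕ L.Constants → Trm L n) fun t => ?_
  cases t with
  | var i => exact ⟨.inl i, rfl⟩
  | cst c => exact ⟨.inr c, rfl⟩

instance AtomIndex.finite [Finite L.Symbols] (n : ℕ) : Finite (AtomIndex L n) := by
  have := Trm.finite (L := L) n
  have : Finite (Σ k, L.Relations k) :=
    Finite.of_injective (Sum.inr : _ → L.Symbols) Sum.inr_injective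
  infer_instance

variable {P : Type*}

/-- The truth of an atomic formula. -/
def AtomIndex.Holds (U : SStruct L A P) {n : ℕ} (a : Fin n → P) : AtomIndex L n → Prop
  | .inl (s, t) => s.val U a = t.val U a
  | .inr ⟨R, t⟩ => U.rel R.2 (fun i => (t i).val U a) ≠ 0

open Classical in
/-- The literal that decides an atomic formula in the way it is decided in `U`. -/
noncomputable def AtomIndex.literal (U : SStruct L A P) {n : ℕ} (a : Fin n → P) :
    AtomIndex L n → Fml L n
  | .inl (s, t) => if s.val U a = t.val U a then .eq s t else .neq s t
  | .inr ⟨R, t⟩ => if U.rel R.2 (fun i => (t i).val U a) ≠ 0 then .rel R.2 t else .nrel R.2 t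

theorem AtomIndex.isLocal_literal (U : SStruct L A P) {n : ℕ} (a : Fin n → P) (r : ℕ) (i : Fin n)
    (α : AtomIndex L n) : (α.literal U a).IsLocal r i := by
  rcases α with ⟨s, t⟩ | ⟨R, t⟩ <;> simp only [AtomIndex.literal] <;> split_ifs <;> trivial

theorem AtomIndex.val_literal_ne_zero (hA : IsMinMax A) (hT : T.ModelDefining)
    (U : SStruct L A P) {n : ℕ} (a : Fin n → P) (b : Fin n → N) (α : AtomIndex L n) :
    (α.literal U a).val T b ≠ 0 ↔ (α.Holds U a ↔ α.Holds T b) := by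
  rcases α with ⟨s, t⟩ | ⟨R, t⟩ <;> simp only [AtomIndex.literal, AtomIndex.Holds] <;>
    split_ifs with h
  · simp [Fml.val_eq_ne_zero hA, h]
  · simp [Fml.val_neq_ne_zero hA, h]
  · simp [Fml.val, h]
  · rw [Fml.val_nrel_ne_zero hT]; simp [Fml.val, h]

variable [Finite L.Symbols]

/-- The conjunction of all literals that hold for the tuple `a`. -/
noncomputable def diagram (U : SStruct L A P) {n : ℕ} (a : Fin (n + 1) → P) : Fml L (n + 1) :=
  Fml.listConj ((Fintype.ofFinite (AtomIndex L (n + 1))).elems.toList.map (·.literal U a))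

theorem isLocal_diagram (U : SStruct L A P) {n : ℕ} (a : Fin (n + 1) → P) (r : ℕ)
    (i : Fin (n + 1)) : (diagram U a).IsLocal r i := by
  refine Fml.isLocal_listConj fun φ hφ => ?_
  obtain ⟨α, -, rfl⟩ := List.mem_map.1 hφ
  exact α.isLocal_literal U a r i

theorem val_diagram_ne_zero (hA : IsMinMax A) (hT : T.ModelDefining) (U : SStruct L A P) {n : ℕ}
    (a : Fin (n + 1) → P) (b : Fin (n + 1) → N) :
    (diagram U a).val T b ≠ 0 ↔ ∀ α : AtomIndex L (n + 1), α.Holds U a ↔ α.Holds T b := by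
  have hm : ∀ α : AtomIndex L (n + 1),
      α ∈ (Fintype.ofFinite (AtomIndex L (n + 1))).elems.toList := fun α =>
    Finset.mem_toList.2 ((Fintype.ofFinite (AtomIndex L (n + 1))).complete α)
  simp only [diagram, Fml.val_listConj_ne_zero hA, List.forall_mem_map,
    AtomIndex.val_literal_ne_zero hA hT, hm, forall_const]

/-- The formula stating that the ball around `x₀` is enumerated by some tuple that begins with
`x₀` and satisfies the same literals as `a`. -/
noncomputable def charFml (r : ℕ) (U : SStruct L A P) {m : ℕ} (a : Fin (m + 1) → P) : Fml L 1 :=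
  Fml.exBalls r m (.and (diagram U a) (.allBall r (.var 0)
    (Fml.listDisj ((List.finRange (m + 1)).map fun i =>
      .eq (.var i.castSucc) (.var (Fin.last (m + 1)))))))

theorem isLocal_charFml (r : ℕ) (U : SStruct L A P) {m : ℕ} (a : Fin (m + 1) → P) :
    (charFml r U a).IsLocal r 0 := by
  refine Fml.isLocal_exBalls ⟨isLocal_diagram U a r 0, rfl, rfl, Fml.isLocal_listDisj ?_⟩
  intro φ hφ
  obtain ⟨i, -, rfl⟩ := List.mem_map.1 hφ
  trivial

/-- The existential string keeps the tuple inside the ball, the universal ball quantifier makes it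
exhaust the ball, and the diagram fixes its atoms. -/
theorem val_charFml_ne_zero (hA : IsMinMax A) (hT : T.ModelDefining) (r : ℕ)
    (U : SStruct L A P) {m : ℕ} (a : Fin (m + 1) → P) (n : N) :
    (charFml r U a).val T (fun _ => n) ≠ 0 ↔ ∃ b : Fin (m + 1) → N, b 0 = n ∧
      Set.range b = T.ball r n ∧ ∀ α : AtomIndex L (m + 1), α.Holds U a ↔ α.Holds T b := by
  rw [charFml, Fml.val_exBalls_ne_zero hA]
  refine exists_congr fun b => and_congr_right fun h0 => ?_
  rw [Fml.val_and_ne_zero hA, val_diagram_ne_zero hA hT, Fml.val_allBall_ne_zero hA]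
  simp only [Fml.val_listDisj_ne_zero hA, List.mem_map, List.mem_finRange, true_and,
    exists_exists_eq_and, Fml.val_eq_ne_zero hA, Trm.val, Fin.snoc_castSucc, Fin.snoc_last, h0]
  rw [Set.Subset.antisymm_iff, Set.range_subset_iff]
  constructor
  · rintro ⟨h1, h2, h3⟩
    exact ⟨⟨h1, fun n hn => h3 n hn⟩, h2⟩
  · rintro ⟨⟨h1, h3⟩, h2⟩
    exact ⟨h1, h2, fun n hn => h3 hn⟩

end Characteristic

/-! ### Region isomorphisms from enumerations with equal diagrams -/

section Enumeration

variable {N : Type y} {P : Type*} {T : SStruct L A N} {U : SStruct L A P}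

/-- Atoms `xᵢ = xⱼ` make `a i ↦ b i` well defined and injective, atoms `xᵢ = c` give the constants,
and relational atoms give the supports. -/
theorem exists_regionMaps_of_atoms {m : ℕ} {a : Fin (m + 1) → P} {b : Fin (m + 1) → N}
    (ha : Set.range a = U.region (a 0)) (hb : Set.range b = T.region (b 0))
    (h : ∀ α : AtomIndex L (m + 1), α.Holds U a ↔ α.Holds T b) :
    ∃ (f : P → N) (g : N → P), f (a 0) = b 0 ∧ RegionMaps U T (a 0) (b 0) f g := by
  have heq : ∀ i j, a i = a j ↔ b i = b j := fun i j => h (.inl (.var i, .var j))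
  have hfac : Function.FactorsThrough b a := fun i j hij => (heq i j).1 hij
  have hfac' : Function.FactorsThrough a b := fun i j hij => (heq i j).2 hij
  -- The default value is taken only outside the region, where nothing is required.
  let f : P → N := Function.extend a b fun _ => b 0
  let g : N → P := Function.extend b a fun _ => a 0
  have hf : ∀ i, f (a i) = b i := fun i => hfac.extend_apply _ i
  have hg : ∀ i, g (b i) = a i := fun i => hfac'.extend_apply _ i
  refine ⟨f, g, hf 0, ?_, ?_, ?_, ?_, fun c => ?_, fun {k} R s hs => ?_⟩
  · rw [← ha, ← hb]; rintro _ ⟨i, rfl⟩; exact ⟨i, (hf i).symm⟩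
  · rw [← ha, ← hb]; rintro _ ⟨i, rfl⟩; exact ⟨i, (hg i).symm⟩
  · rw [← ha]; rintro _ ⟨i, rfl⟩; rw [hf, hg]
  · rw [← hb]; rintro _ ⟨i, rfl⟩; rw [hg, hf]
  · have hc := U.const_mem_region (a 0) c
    rw [← ha] at hc
    obtain ⟨i, hi⟩ := hc
    rw [← hi, hf]
    exact (h (.inl (.var i, .cst c))).1 hi
  · rw [← ha] at hs
    choose ι hι using hs
    obtain rfl : a ∘ ι = s := funext hι
    have : f ∘ a ∘ ι = b ∘ ι := funext fun i => hf _
    rw [this]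
    exact h (.inr ⟨⟨k, R⟩, fun i => .var (ι i)⟩)

theorem RegionMaps.holds_iff {m : ℕ} {a : Fin (m + 1) → P} {p : P} {n : N} {f : P → N} {g : N → P}
    (h : RegionMaps U T p n f g) (ha : ∀ i, a i ∈ U.region p) (α : AtomIndex L (m + 1)) :
    α.Holds U a ↔ α.Holds T (f ∘ a) := by
  have hmem : ∀ t : Trm L (m + 1), t.val U a ∈ U.region p := by
    rintro (i | c)
    · exact ha i
    · exact U.const_mem_region p c
  have hval : ∀ t : Trm L (m + 1), t.val T (f ∘ a) = f (t.val U a) := by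
    rintro (i | c)
    · rfl
    · exact (h.const c).symm
  rcases α with ⟨s, t⟩ | ⟨R, t⟩
  · simp only [AtomIndex.Holds, hval]
    refine ⟨fun e => by rw [e], fun e => ?_⟩
    rw [← h.left_inv _ (hmem s), e, h.left_inv _ (hmem t)]
  · simp only [AtomIndex.Holds, hval]
    exact h.rel R.2 _ fun i => hmem (t i)

theorem exists_enumeration [Finite P] (U : SStruct L A P) (p : P) :
    ∃ (m : ℕ) (a : Fin (m + 1) → P), a 0 = p ∧ Set.range a = U.region p := by
  obtain ⟨m, ⟨e⟩⟩ := Finite.exists_equiv_fin (U.region p)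
  -- `p` is listed twice; repetitions are harmless, and this puts it at index `0`.
  refine ⟨m, Fin.cons p fun i => (e.symm i).1, rfl, ?_⟩
  rw [Fin.range_cons]
  have : Set.range (fun i => (e.symm i).1) = U.region p := by
    rw [Set.range_comp' Subtype.val, e.symm.range_eq_univ, Set.image_univ, Subtype.range_coe]
  rw [this, Set.insert_eq_of_mem (U.mem_region_self p)]

variable [Finite L.Symbols] [Fintype N]

/-- The formula fixes the type of a pointed region. Letting the point `n'` move within its component
leaves exactly the type of the component. -/
theorem regionIso_iff_exists_charFml (hA : IsMinMax A) (hT : T.ModelDefining) {r : ℕ}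
    (hr : Fintype.card N ≤ r) {m : ℕ} {a : Fin (m + 1) → P}
    (ha : Set.range a = U.region (a 0)) (n : N) :
    RegionIso U T (a 0) n ↔
      ∃ n', T.gaifman.Reachable n n' ∧ (charFml r U a).val T (fun _ => n') ≠ 0 := by
  simp only [val_charFml_ne_zero hA hT, T.ball_eq_region hr]
  constructor
  · intro h
    obtain ⟨f, g, hn, h⟩ := h.exists_maps
    have hmem : ∀ i, a i ∈ U.region (a 0) := fun i => ha ▸ ⟨i, rfl⟩
    refine ⟨_, hn, f ∘ a, rfl, Set.Subset.antisymm ?_ fun v hv => ?_, h.holds_iff hmem⟩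
    · rintro _ ⟨i, rfl⟩
      exact h.map _ (hmem i)
    · have hg := h.map' v hv
      rw [← ha] at hg
      obtain ⟨i, hi⟩ := hg
      exact ⟨i, by simp [hi, h.right_inv v hv]⟩
  · rintro ⟨n', hn, b, rfl, hb, h⟩
    obtain ⟨f, g, h0, h⟩ := exists_regionMaps_of_atoms ha hb h
    rw [← h0] at h hn
    exact h.regionIso.congr_right hn.symm

end Enumeration

/-! ## Counting components -/

section Counting

/-- The basic local sentence stating that `ψ` holds at `k + 1` elements with pairwise distance
greater than `2 r`. -/
def basicLocal (r k : ℕ) (ψ : Fml L 1) : Fml L 0 :=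
  .exScat r (k + 1) (Fml.conj k fun i => ψ.rename fun _ => Fin.natAdd 0 i)

theorem models_basicLocal_iff (hA : IsMinMax A) {N : Type y} [Fintype N] (T : SStruct L A N)
    (r k : ℕ) (ψ : Fml L 1) : T.Models (basicLocal r k ψ) ↔
      ∃ b : Fin (k + 1) → N, T.Scattered r b ∧ ∀ i, ψ.val T (fun _ => b i) ≠ 0 := by
  rw [SStruct.Models, basicLocal, Fml.val_exScat_ne_zero hA]
  refine exists_congr fun b => and_congr_right fun _ => ?_
  rw [Fml.val_conj_ne_zero hA]
  refine forall_congr' fun i => ?_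
  rw [Fml.val_rename]
  have : Fin.append Fin.elim0 b ∘ (fun _ : Fin 1 => Fin.natAdd 0 i) = fun _ => b i :=
    funext fun _ => Fin.append_right _ _ i
  rw [this]

variable [Finite L.Symbols]

/-- Scattered witnesses lie in distinct components of the right type; conversely, each such
component contains a witness, and witnesses from distinct components are scattered. -/
theorem models_basicLocal_charFml_iff (hA : IsMinMax A) {N : Type y} [Fintype N]
    {T : SStruct L A N} (hT : T.ModelDefining) {P : Type*} (U : SStruct L A P) {r : ℕ}
    (hr : Fintype.card N ≤ r) {m : ℕ} {a : Fin (m + 1) → P}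
    (ha : Set.range a = U.region (a 0)) (k : ℕ) :
    T.Models (basicLocal r k (charFml r U a)) ↔
      k + 1 ≤ Nat.card {E : T.gaifman.ConnectedComponent // RegionIso U T (a 0) (Quot.out E)} := by
  have : Finite T.gaifman.ConnectedComponent := Quot.finite _
  have := Fintype.ofFinite
    {E : T.gaifman.ConnectedComponent // RegionIso U T (a 0) (Quot.out E)}
  rw [models_basicLocal_iff hA, Nat.card_eq_fintype_card]
  constructor
  · rintro ⟨b, hb, h⟩
    rw [T.scattered_iff hr] at hb
    have := Fintype.card_le_of_injective (fun i : Fin (k + 1) =>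
      (⟨T.gaifman.connectedComponentMk (b i), (regionIso_iff_exists_charFml hA hT hr ha _).2
        ⟨b i, reachable_out _ _, h i⟩⟩ :
        {E : T.gaifman.ConnectedComponent // RegionIso U T (a 0) (Quot.out E)}))
      fun i j hij => hb (congrArg Subtype.val hij)
    simpa using this
  · intro hk
    obtain ⟨e⟩ := Function.Embedding.nonempty_of_card_le (α := Fin (k + 1))
      (β := {E : T.gaifman.ConnectedComponent // RegionIso U T (a 0) (Quot.out E)}) (by simpa)
    choose b hb h using fun i => (regionIso_iff_exists_charFml hA hT hr ha _).1 (e i).2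
    refine ⟨b, (T.scattered_iff hr b).2 fun i j hij => e.injective (Subtype.ext ?_), h⟩
    have hc : ∀ i, T.gaifman.connectedComponentMk (b i) = (e i).1 := fun i => by
      rw [← Quot.out_eq (e i).1]
      exact (SimpleGraph.ConnectedComponent.sound (hb i)).symm
    rw [← hc, ← hc]
    exact hij

variable {M : Type x} [Fintype M] {N : Type y} [Fintype N]
  {S : SStruct L A M} {T : SStruct L A N}

theorem card_regionIso_eq (hA : IsMinMax A) (hS : S.ModelDefining) (hT : T.ModelDefining)
    (h : ∀ σ : Fml L 0, IsBasicLocal σ → (S.Models σ ↔ T.Models σ))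
    {P : Type*} [Finite P] (U : SStruct L A P) (p : P) :
    Nat.card {D : S.gaifman.ConnectedComponent // RegionIso U S p (Quot.out D)} =
      Nat.card {E : T.gaifman.ConnectedComponent // RegionIso U T p (Quot.out E)} := by
  obtain ⟨m, a, rfl, ha⟩ := exists_enumeration U p
  have key : ∀ k, k + 1 ≤ _ ↔ k + 1 ≤ _ := fun k =>
    -- The same sentence is evaluated in both models, so its radius must be large enough for both.
    (models_basicLocal_charFml_iff hA hS U (r := Fintype.card M + Fintype.card N)
      (by omega) ha k).symm.trans ((h _ ⟨_, k, _, isLocal_charFml _ U a, rfl⟩).trans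
      (models_basicLocal_charFml_iff hA hT U (by omega) ha k))
  -- A natural number is determined by its lower bounds; the bound `0`, which no basic local
  -- sentence expresses, is trivial.
  refine eq_of_forall_le_iff fun k => ?_
  cases k with
  | zero => simp
  | succ k => exact key k

theorem exists_componentEquiv (hA : IsMinMax A) (hS : S.ModelDefining) (hT : T.ModelDefining)
    (h : ∀ σ : Fml L 0, IsBasicLocal σ → (S.Models σ ↔ T.Models σ)) :
    ∃ β : S.gaifman.ConnectedComponent ≃ T.gaifman.ConnectedComponent,
      ∀ D, RegionIso S T (Quot.out D) (Quot.out (β D)) := by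
  have : Finite S.gaifman.ConnectedComponent := Quot.finite _
  have : Finite T.gaifman.ConnectedComponent := Quot.finite _
  -- Each component is coloured by the set of all points of either model having its type. Equal
  -- colours mean equal types, across the two models as well, so it remains to match the fibres of
  -- `κ` and `κ'`.
  let κ : S.gaifman.ConnectedComponent → Set (M ⊕ N) := fun D =>
    {z | z.elim (RegionIso S S · (Quot.out D)) (RegionIso T S · (Quot.out D))}
  let κ' : T.gaifman.ConnectedComponent → Set (M ⊕ N) := fun E =>
    {z | z.elim (RegionIso S T · (Quot.out E)) (RegionIso T T · (Quot.out E))}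
  have hSS : ∀ D₀ D, κ D = κ D₀ ↔ RegionIso S S (Quot.out D₀) (Quot.out D) := by
    refine fun D₀ D => ⟨fun e => ?_, fun e => Set.ext ?_⟩
    · have : Sum.inl (Quot.out D₀) ∈ κ D := e ▸ RegionIso.refl S (Quot.out D₀)
      exact this
    · rintro (z | z) <;> exact ⟨fun hz => RegionIso.trans hz e.symm, fun hz => RegionIso.trans hz e⟩
  have hST : ∀ D₀ E, κ' E = κ D₀ ↔ RegionIso S T (Quot.out D₀) (Quot.out E) := by
    refine fun D₀ E => ⟨fun e => ?_, fun e => Set.ext ?_⟩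
    · have : Sum.inl (Quot.out D₀) ∈ κ' E := e ▸ RegionIso.refl S (Quot.out D₀)
      exact this
    · rintro (z | z) <;> exact ⟨fun hz => RegionIso.trans hz e.symm, fun hz => RegionIso.trans hz e⟩
  have hTT : ∀ E₀ E, κ' E = κ' E₀ ↔ RegionIso T T (Quot.out E₀) (Quot.out E) := by
    refine fun E₀ E => ⟨fun e => ?_, fun e => Set.ext ?_⟩
    · have : Sum.inr (Quot.out E₀) ∈ κ' E := e ▸ RegionIso.refl T (Quot.out E₀)
      exact this
    · rintro (z | z) <;> exact ⟨fun hz => RegionIso.trans hz e.symm, fun hz => RegionIso.trans hz e⟩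
  have hTS : ∀ E₀ D, κ D = κ' E₀ ↔ RegionIso T S (Quot.out E₀) (Quot.out D) := fun E₀ D =>
    eq_comm.trans ((hST D E₀).trans ⟨RegionIso.symm, RegionIso.symm⟩)
  have hcard : ∀ v, Nonempty ({D // κ D = v} ≃ {E // κ' E = v}) := by
    intro v
    by_cases hv : ∃ D₀, κ D₀ = v
    · obtain ⟨D₀, rfl⟩ := hv
      simp only [hSS, hST]
      exact (Finite.card_eq).1 (card_regionIso_eq hA hS hT h S _)
    by_cases hv' : ∃ E₀, κ' E₀ = v
    · obtain ⟨E₀, rfl⟩ := hv'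
      simp only [hTS, hTT]
      exact (Finite.card_eq).1 (card_regionIso_eq hA hS hT h T _)
    · have : IsEmpty {D // κ D = v} := ⟨fun D => hv ⟨D.1, D.2⟩⟩
      have : IsEmpty {E // κ' E = v} := ⟨fun E => hv' ⟨E.1, E.2⟩⟩
      exact ⟨Equiv.equivOfIsEmpty _ _⟩
  let e := fun v => (hcard v).some
  refine ⟨Equiv.ofFiberEquiv e, fun D => (hST _ _).1 (Equiv.ofFiberEquiv_map e D)⟩

end Counting

end SemiringGaifman

theorem mainTheorem9 {L : FirstOrder.Language.{u, v}} [Finite L.Symbols]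
    (hL : ∀ k : ℕ, 0 < k → IsEmpty (L.Functions k))
    {A : Type w} [CommSemiring A] (hA : SemiringGaifman.IsMinMax A)
    {M : Type x} [Fintype M] [Nonempty M] {N : Type y} [Fintype N] [Nonempty N]
    (S : SemiringGaifman.SStruct L A M) (T : SemiringGaifman.SStruct L A N)
    (hS : S.ModelDefining) (hT : T.ModelDefining)
    (h : ∀ σ : SemiringGaifman.Fml L 0, SemiringGaifman.IsBasicLocal σ →
      (S.Models σ ↔ T.Models σ)) :
    ∀ φ : SemiringGaifman.Fml L 0, S.Models φ ↔ T.Models φ := by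
  obtain ⟨β, hβ⟩ := SemiringGaifman.exists_componentEquiv hA hS hT h
  obtain ⟨F, hF⟩ := SemiringGaifman.exists_supportIso β hβ
  intro φ
  have := hF.val_ne_zero hA hS hT φ Fin.elim0
  rwa [Subsingleton.elim (F ∘ Fin.elim0) Fin.elim0] at this
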